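/- For a graph $G$ and two distinct edges $e_1,e_2$ of $G$, let the distance be $d'(e_1,e_2)=k$ if at least $k-1$ edges are needed to connect an endpoint of $e_1$ with an endpoint of $e_2$; so distinct edges sharing an endpoint are at distance $1$, and disjoint edges joined by an edge are at distance $2$. For integers $h,k\ge 0$, an $L(h,k)$-edge labeling of $G$ is a function $f':E(G)\to\{0,1,\dots,n\}$ such that $|f'(e_1)-f'(e_2)|\ge h$ whenever $d'(e_1,e_2)=1$ and $|f'(e_1)-f'(e_2)|\ge k$ whenever $d'(e_1,e_2)=2$. The span $\lambda'_{h,k}(G)$ is the least $n$ for which $G$ has an $L(h,k)$-edge labeling with labels in $\{0,1,\dots,n\}$. Let $T_8$ be the infinite regular octagonal grid: its vertex set is $\mathbb{Z}^2$, and two distinct points $(x,y)$, $(x',y')$ are adjacent if and only if $|x-x'|\le 1$ and $|y-y'|\le 1$. Theorem. The span $\lambda'_{1,2}(T_8)$ exists (is finite), and $\lambda'_{1,2}(T_8)\ge 28$. -/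

import Mathlib

namespace SimpleGraph

/-- The distance `d'(e₁, e₂)` between two edges of a graph.  Two distinct edges are at distance
`k` when at least `k - 1` edges are needed to connect them: distinct edges that share an endpoint
are at distance `1`, disjoint edges that are joined by an edge are at distance `2`, and so on.
It is `⊤` for edges in different components, and an edge is at distance `0` from itself. -/
noncomputable def edgeDist {V : Type*} (G : SimpleGraph V) (e₁ e₂ : G.edgeSet) : ℕ∞ :=
  open Classical in
  if e₁ = e₂ then 0
  else (⨅ u ∈ (e₁ : Sym2 V), ⨅ v ∈ (e₂ : Sym2 V), G.edist u v) + 1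

/-- `f` is an `L(h, k)`-edge labeling of `G` with labels in `{0, 1, …, n}`. -/
def IsEdgeLabeling {V : Type*} (G : SimpleGraph V) (h k n : ℕ) (f : G.edgeSet → ℕ) : Prop :=
  (∀ e, f e ≤ n) ∧
  ∀ e₁ e₂ : G.edgeSet,
    (G.edgeDist e₁ e₂ = 1 → (h : ℤ) ≤ |(f e₁ : ℤ) - (f e₂ : ℤ)|) ∧
    (G.edgeDist e₁ e₂ = 2 → (k : ℤ) ≤ |(f e₁ : ℤ) - (f e₂ : ℤ)|)

/-- The span `λ'_{h,k}(G)`: the least `n` such that `G` has an `L(h, k)`-edge labeling with labels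
in `{0, 1, …, n}`; it is `⊤` when there is no such `n`. -/
noncomputable def edgeSpan {V : Type*} (G : SimpleGraph V) (h k : ℕ) : ℕ∞ :=
  ⨅ n ∈ {n : ℕ | ∃ f : G.edgeSet → ℕ, G.IsEdgeLabeling h k n f}, (n : ℕ∞)

end SimpleGraph

/-- The infinite regular octagonal grid `T₈`: the vertices are the points of `ℤ²`, and every vertex
is joined to the eight surrounding points by horizontal, vertical and slanting edges. -/
def octagonalGrid : SimpleGraph (ℤ × ℤ) where
  Adj p q := p ≠ q ∧ |p.1 - q.1| ≤ 1 ∧ |p.2 - q.2| ≤ 1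
  symm := ⟨fun p q h => ⟨h.1.symm, by rw [abs_sub_comm]; exact h.2.1,
    by rw [abs_sub_comm]; exact h.2.2⟩⟩
  loopless := ⟨fun _ h => h.1 rfl⟩

namespace SimpleGraph

variable {V : Type*} {G : SimpleGraph V}

/-! The lower bound is a discharging count. Any two edges touching a `2 × 2` block are at distance
at most 2, so the 26 edges touching it have distinct labels; if `n ≤ 27`, at most 3 of the values
`0, …, n + 1` are missing there. Each edge labelled `c` touches some block where `c + 1` is missing
(`exists_touches_succ_missing`), and block and value together determine the edge. The grid has four
edges per block, so a large window would need nearly 4 missing values per block on average. -/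

theorem edgeDist_ne (e₁ e₂ : G.edgeSet) (h : e₁ ≠ e₂) :
    G.edgeDist e₁ e₂ = (⨅ u ∈ (e₁ : Sym2 V), ⨅ v ∈ (e₂ : Sym2 V), G.edist u v) + 1 := by
  simp [edgeDist, h]

theorem edgeDist_eq_one {e₁ e₂ : G.edgeSet} (h : e₁ ≠ e₂) {u : V}
    (h₁ : u ∈ (e₁ : Sym2 V)) (h₂ : u ∈ (e₂ : Sym2 V)) : G.edgeDist e₁ e₂ = 1 := by
  rw [edgeDist_ne _ _ h]
  have : (⨅ u ∈ (e₁ : Sym2 V), ⨅ v ∈ (e₂ : Sym2 V), G.edist u v) ≤ 0 :=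
    iInf₂_le_of_le u h₁ (iInf₂_le_of_le u h₂ (by simp))
  rw [nonpos_iff_eq_zero.1 this, zero_add]

theorem edgeDist_eq_two {e₁ e₂ : G.edgeSet}
    (h : ∀ u ∈ (e₁ : Sym2 V), u ∉ (e₂ : Sym2 V)) {u v : V}
    (h₁ : u ∈ (e₁ : Sym2 V)) (h₂ : v ∈ (e₂ : Sym2 V)) (huv : G.Adj u v) :
    G.edgeDist e₁ e₂ = 2 := by
  have hne : e₁ ≠ e₂ := fun he => h u h₁ (he ▸ h₁)
  rw [edgeDist_ne _ _ hne]
  have hle : (⨅ u ∈ (e₁ : Sym2 V), ⨅ v ∈ (e₂ : Sym2 V), G.edist u v) ≤ 1 :=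
    iInf₂_le_of_le u h₁ (iInf₂_le_of_le v h₂ (edist_eq_one_iff_adj.2 huv).le)
  have hge : 1 ≤ (⨅ u ∈ (e₁ : Sym2 V), ⨅ v ∈ (e₂ : Sym2 V), G.edist u v) := by
    refine le_iInf₂ fun a ha => le_iInf₂ fun b hb => ?_
    rw [Order.one_le_iff_pos]
    exact edist_pos_of_ne fun hab => h a ha (hab ▸ hb)
  rw [le_antisymm hle hge, one_add_one_eq_two]

theorem exists_edist_le_of_edgeDist {e₁ e₂ : G.edgeSet} {k : ℕ}
    (h : G.edgeDist e₁ e₂ = k + 1) :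
    ∃ u ∈ (e₁ : Sym2 V), ∃ v ∈ (e₂ : Sym2 V), G.edist u v ≤ k := by
  have hne : e₁ ≠ e₂ := by
    rintro rfl
    simp [edgeDist, eq_comm (a := (0 : ℕ∞))] at h
  rw [edgeDist_ne _ _ hne] at h
  by_contra! hc
  have hge : (k : ℕ∞) + 1 ≤ (⨅ u ∈ (e₁ : Sym2 V), ⨅ v ∈ (e₂ : Sym2 V), G.edist u v) :=
    le_iInf₂ fun a ha => le_iInf₂ fun b hb => Order.add_one_le_of_lt (hc a ha b hb)
  have h' := add_le_add_left hge 1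
  rw [h] at h'
  norm_cast at h'
  omega

end SimpleGraph

namespace octagonalGrid

open SimpleGraph

theorem adj_iff {p q : ℤ × ℤ} :
    octagonalGrid.Adj p q ↔ p ≠ q ∧ |p.1 - q.1| ≤ 1 ∧ |p.2 - q.2| ≤ 1 := Iff.rfl

theorem abs_sub_le_of_mem {e : Sym2 (ℤ × ℤ)} (he : e ∈ octagonalGrid.edgeSet) {u v : ℤ × ℤ}
    (hu : u ∈ e) (hv : v ∈ e) : |u.1 - v.1| ≤ 1 ∧ |u.2 - v.2| ≤ 1 := by
  by_cases huv : u = v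
  · simp [huv]
  · rw [(Sym2.mem_and_mem_iff huv).1 ⟨hu, hv⟩, mem_edgeSet] at he
    exact he.2

theorem abs_sub_le_of_edist_le_one {u v : ℤ × ℤ} (h : octagonalGrid.edist u v ≤ 1) :
    |u.1 - v.1| ≤ 1 ∧ |u.2 - v.2| ≤ 1 := by
  rcases h.eq_or_lt with h | h
  · exact (edist_eq_one_iff_adj.1 h).2
  · rw [Order.lt_one_iff, edist_eq_zero_iff] at h
    simp [h]

/-! ### A labeling with finitely many labels -/

/-- The residues modulo `5` of the two endpoints of an edge. -/
noncomputable def residues (e : Sym2 (ℤ × ℤ)) : (ZMod 5 × ZMod 5) × (ZMod 5 × ZMod 5) :=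
  (((e.out.1.1 : ℤ), (e.out.1.2 : ℤ)), ((e.out.2.1 : ℤ), (e.out.2.2 : ℤ)))

/-- Endpoints of the two edges differ by at most 1 + 1 + 1 = 3 in each coordinate, so residues
modulo 5 determine them. -/
theorem eq_of_residues_eq {e₁ e₂ : octagonalGrid.edgeSet} {u v : ℤ × ℤ}
    (hu : u ∈ (e₁ : Sym2 (ℤ × ℤ))) (hv : v ∈ (e₂ : Sym2 (ℤ × ℤ)))
    (huv : |u.1 - v.1| ≤ 1 ∧ |u.2 - v.2| ≤ 1)
    (h : residues e₁ = residues e₂) : e₁ = e₂ := by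
  have a₁ := abs_sub_le_of_mem e₁.2 (Sym2.out_fst_mem e₁.1) hu
  have b₁ := abs_sub_le_of_mem e₁.2 (Sym2.out_snd_mem e₁.1) hu
  have a₂ := abs_sub_le_of_mem e₂.2 (Sym2.out_fst_mem e₂.1) hv
  have b₂ := abs_sub_le_of_mem e₂.2 (Sym2.out_snd_mem e₂.1) hv
  simp only [residues, Prod.mk.injEq, ZMod.intCast_eq_intCast_iff_dvd_sub] at h
  push_cast at h
  simp only [abs_le] at *
  have h₁ : e₁.1.out.1 = e₂.1.out.1 := by ext <;> omega
  have h₂ : e₁.1.out.2 = e₂.1.out.2 := by ext <;> omega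
  apply Subtype.ext
  rw [← Quot.out_eq e₁.1, ← Quot.out_eq e₂.1]
  exact congrArg _ (Prod.ext h₁ h₂)

theorem exists_isEdgeLabeling :
    ∃ (n : ℕ) (f : octagonalGrid.edgeSet → ℕ), octagonalGrid.IsEdgeLabeling 1 2 n f := by
  let c : (ZMod 5 × ZMod 5) × (ZMod 5 × ZMod 5) ≃ Fin _ := Fintype.equivFin _
  -- Doubling separates distinct labels by 2, which serves both distances at once.
  have key : ∀ e₁ e₂ : octagonalGrid.edgeSet, ∀ k : ℕ, k ≤ 1 →
      octagonalGrid.edgeDist e₁ e₂ = k + 1 →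
      (2 : ℤ) ≤ |((2 * (c (residues e₁) : ℕ) : ℕ) : ℤ) - ((2 * (c (residues e₂) : ℕ) : ℕ) : ℤ)| := by
    intro e₁ e₂ k hk h
    have hne : (c (residues e₁) : ℕ) ≠ c (residues e₂) := by
      intro hc
      obtain ⟨u, hu, v, hv, huv⟩ := exists_edist_le_of_edgeDist h
      have := eq_of_residues_eq hu hv
        (abs_sub_le_of_edist_le_one (huv.trans (by exact_mod_cast hk)))
        (c.injective (Fin.ext hc))
      subst this
      simp [edgeDist, eq_comm (a := (0 : ℕ∞))] at h
    rw [le_abs]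
    omega
  refine ⟨2 * Fintype.card ((ZMod 5 × ZMod 5) × (ZMod 5 × ZMod 5)),
    fun e => 2 * c (residues e), fun e => Nat.mul_le_mul_left 2 (c (residues e)).2.le, fun e₁ e₂ => ?_⟩
  refine ⟨fun h => ?_, fun h => ?_⟩
  · have := key e₁ e₂ 0 (by norm_num) (by simpa using h)
    push_cast at *
    omega
  · exact key e₁ e₂ 1 le_rfl (by rw [h]; rfl)

/-! ### Blocks of four mutually adjacent vertices -/

/-- The `2 × 2` block of vertices whose lower left corner is `b`. -/
def block (b : ℤ × ℤ) : Set (ℤ × ℤ) :=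
  {v | (b.1 ≤ v.1 ∧ v.1 ≤ b.1 + 1) ∧ b.2 ≤ v.2 ∧ v.2 ≤ b.2 + 1}

theorem mem_block {b v : ℤ × ℤ} :
    v ∈ block b ↔ (b.1 ≤ v.1 ∧ v.1 ≤ b.1 + 1) ∧ b.2 ≤ v.2 ∧ v.2 ≤ b.2 + 1 := Iff.rfl

/-- The edge `e` has an endpoint in the block at `b`. -/
def Touches (e : octagonalGrid.edgeSet) (b : ℤ × ℤ) : Prop :=
  ∃ v ∈ (e : Sym2 (ℤ × ℤ)), v ∈ block b

theorem adj_of_mem_block {b u v : ℤ × ℤ} (hu : u ∈ block b) (hv : v ∈ block b) (h : u ≠ v) :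
    octagonalGrid.Adj u v := by
  rw [mem_block] at hu hv
  refine ⟨h, ?_, ?_⟩ <;> rw [abs_le] <;> omega

section Labeling

variable {n : ℕ} {f : octagonalGrid.edgeSet → ℕ}

theorem ne_of_share (hf : octagonalGrid.IsEdgeLabeling 1 2 n f)
    {e₁ e₂ : octagonalGrid.edgeSet} (h : e₁ ≠ e₂) {v : ℤ × ℤ}
    (h₁ : v ∈ (e₁ : Sym2 (ℤ × ℤ))) (h₂ : v ∈ (e₂ : Sym2 (ℤ × ℤ))) : f e₁ ≠ f e₂ := by
  have := (hf.2 e₁ e₂).1 (edgeDist_eq_one h h₁ h₂)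
  intro he
  simp [he] at this

theorem share_or_two_le (hf : octagonalGrid.IsEdgeLabeling 1 2 n f)
    {e₁ e₂ : octagonalGrid.edgeSet} {u v : ℤ × ℤ}
    (hu : u ∈ (e₁ : Sym2 (ℤ × ℤ))) (hv : v ∈ (e₂ : Sym2 (ℤ × ℤ)))
    (huv : u ≠ v → octagonalGrid.Adj u v) :
    (∃ w ∈ (e₁ : Sym2 (ℤ × ℤ)), w ∈ (e₂ : Sym2 (ℤ × ℤ))) ∨ 2 ≤ |(f e₁ : ℤ) - f e₂| := by
  by_cases h : ∃ w ∈ (e₁ : Sym2 (ℤ × ℤ)), w ∈ (e₂ : Sym2 (ℤ × ℤ))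
  · exact Or.inl h
  · push Not at h
    exact Or.inr ((hf.2 e₁ e₂).2 (edgeDist_eq_two h hu hv
      (huv fun he => h u hu (he ▸ hv))))

theorem ne_of_near (hf : octagonalGrid.IsEdgeLabeling 1 2 n f)
    {e₁ e₂ : octagonalGrid.edgeSet} (hne : e₁ ≠ e₂) {u v : ℤ × ℤ}
    (hu : u ∈ (e₁ : Sym2 (ℤ × ℤ))) (hv : v ∈ (e₂ : Sym2 (ℤ × ℤ)))
    (huv : u ≠ v → octagonalGrid.Adj u v) : f e₁ ≠ f e₂ := by
  rcases share_or_two_le hf hu hv huv with ⟨w, h₁, h₂⟩ | h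
  · exact ne_of_share hf hne h₁ h₂
  · intro he
    simp [he] at h

theorem injOn_touches (hf : octagonalGrid.IsEdgeLabeling 1 2 n f)
    (b : ℤ × ℤ) : Set.InjOn f {e | Touches e b} := by
  rintro e₁ ⟨u, hu, hub⟩ e₂ ⟨v, hv, hvb⟩ h
  by_contra hne
  exact ne_of_near hf hne hu hv (adj_of_mem_block hub hvb) h

/-- Among the four blocks containing `p`, take those on the side away from `q`: one if `q` is
diagonal to `p`, otherwise two. In the second case a neighbour of `q` other than `p` lies in at most
one of them, in the first case in none. -/
theorem exists_block_avoiding {p q r : ℤ × ℤ} (hpq : octagonalGrid.Adj p q)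
    (hqr : octagonalGrid.Adj q r) (hrp : r ≠ p) :
    ∃ b, p ∈ block b ∧ q ∉ block b ∧ r ∉ block b := by
  rw [adj_iff] at hpq hqr
  simp only [abs_le, ne_eq, Prod.ext_iff, not_and_or] at *
  by_contra! h
  have h₁ := h (p.1, p.2)
  have h₂ := h (p.1 - 1, p.2)
  have h₃ := h (p.1, p.2 - 1)
  have h₄ := h (p.1 - 1, p.2 - 1)
  simp only [mem_block] at h₁ h₂ h₃ h₄
  omega

/-- Two edges whose labels are consecutive and that touch a common block share an endpoint, and
then some block at the other end of the first edge avoids the second edge. -/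
theorem exists_touches_succ_missing (hf : octagonalGrid.IsEdgeLabeling 1 2 n f)
    (e : octagonalGrid.edgeSet) :
    ∃ b, Touches e b ∧ ∀ e', Touches e' b → f e' ≠ f e + 1 := by
  by_cases hs : ∃ e', f e' = f e + 1 ∧ ∃ w ∈ (e : Sym2 (ℤ × ℤ)), w ∈ (e' : Sym2 (ℤ × ℤ))
  · obtain ⟨e', he', q, hq, hq'⟩ := hs
    obtain ⟨p, hp⟩ := hq
    obtain ⟨r, hr⟩ := hq'
    have hqp : octagonalGrid.Adj q p := by rw [← mem_edgeSet, ← hp]; exact e.2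
    have hqr : octagonalGrid.Adj q r := by rw [← mem_edgeSet, ← hr]; exact e'.2
    have hrp : r ≠ p := by
      rintro rfl
      have : e = e' := Subtype.ext (hp.trans hr.symm)
      subst this
      omega
    obtain ⟨b, hpb, hqb, hrb⟩ := exists_block_avoiding hqp.symm hqr hrp
    have hpe : p ∈ (e : Sym2 (ℤ × ℤ)) := by simp [hp]
    have hqe : q ∈ (e : Sym2 (ℤ × ℤ)) := by simp [hp]
    refine ⟨b, ⟨p, hpe, hpb⟩, ?_⟩
    rintro e'' ⟨v, hv, hvb⟩ h
    have hne : e'' ≠ e' := by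
      rintro rfl
      rw [hr, Sym2.mem_iff] at hv
      rcases hv with rfl | rfl <;> contradiction
    rcases share_or_two_le hf hpe hv (adj_of_mem_block hpb hvb) with ⟨w, hw, hw'⟩ | h2
    -- `w` is an endpoint of `e`, hence equal or adjacent to `q`, so `e''` is too near `e'` to
    -- repeat its label.
    · refine ne_of_near hf hne hw' (v := q) (by simp [hr]) (fun hwq => ?_) (h.trans he'.symm)
      rw [hp, Sym2.mem_iff] at hw
      rcases hw with rfl | rfl
      · exact absurd rfl hwq
      · exact hqp.symm
    · rw [h, le_abs] at h2
      push_cast at h2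
      omega
  · push Not at hs
    obtain ⟨p, hp⟩ : ∃ p, p ∈ (e : Sym2 (ℤ × ℤ)) := ⟨_, Sym2.out_fst_mem e.1⟩
    have hpb : p ∈ block p := by simp [mem_block]
    refine ⟨p, ⟨p, hp, hpb⟩, ?_⟩
    rintro e' ⟨v, hv, hvb⟩ h
    rcases share_or_two_le hf hp hv (adj_of_mem_block hpb hvb) with ⟨w, hw, hw'⟩ | h2
    · exact hs e' h w hw hw'
    · rw [h, le_abs] at h2
      push_cast at h2
      omega

end Labeling

/-! ### Counting -/

/-- One vector for each of the four directions of edges. -/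
def direction : Fin 4 → ℤ × ℤ := ![(1, 0), (0, 1), (1, 1), (1, -1)]

/-- The edge that leaves `p` in the direction `d`. -/
def edge (p : ℤ × ℤ) (d : Fin 4) : octagonalGrid.edgeSet :=
  ⟨s(p, p + direction d), by
    rw [mem_edgeSet, adj_iff]
    fin_cases d <;> simp [direction, Prod.ext_iff]⟩

theorem edge_injective : Function.Injective fun x : (ℤ × ℤ) × Fin 4 => edge x.1 x.2 := by
  rintro ⟨p, d⟩ ⟨q, d'⟩ h
  simp only [edge, Subtype.mk.injEq, Sym2.eq_iff, Prod.ext_iff, Prod.fst_add, Prod.snd_add] at h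
  have h4 : p.1 = q.1 ∧ p.2 = q.2 ∧ d = d' := by
    fin_cases d <;> fin_cases d' <;> simp [direction] at h ⊢ <;> omega
  exact Prod.ext (Prod.ext h4.1 h4.2.1) h4.2.2

/-- The edges that touch the block at `(0, 0)`. -/
noncomputable def touchingOffsets : Finset ((ℤ × ℤ) × Fin 4) :=
  ((Finset.Icc (-1) 1 ×ˢ Finset.Icc (-1) 2) ×ˢ Finset.univ).filter fun x =>
    ((0 ≤ x.1.1 ∧ x.1.1 ≤ 1) ∧ 0 ≤ x.1.2 ∧ x.1.2 ≤ 1) ∨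
    ((0 ≤ (x.1 + direction x.2).1 ∧ (x.1 + direction x.2).1 ≤ 1) ∧
      0 ≤ (x.1 + direction x.2).2 ∧ (x.1 + direction x.2).2 ≤ 1)

/-- Four vertices of degree 8, with the 6 inner edges counted twice: 32 - 6. -/
theorem card_touchingOffsets : touchingOffsets.card = 26 := by decide +kernel

theorem touches_edge_add (b : ℤ × ℤ) {x : (ℤ × ℤ) × Fin 4} (hx : x ∈ touchingOffsets) :
    Touches (edge (b + x.1) x.2) b := by
  rcases (Finset.mem_filter.1 hx).2 with h | h
  · refine ⟨b + x.1, by simp [edge], ?_⟩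
    rw [mem_block, Prod.fst_add, Prod.snd_add]
    omega
  · refine ⟨b + x.1 + direction x.2, by simp [edge], ?_⟩
    rw [add_assoc, mem_block, Prod.fst_add b, Prod.snd_add b]
    omega

/-- The labels up to `n + 1` that are missing at the block at `b`. -/
noncomputable def missing (f : octagonalGrid.edgeSet → ℕ) (n : ℕ) (b : ℤ × ℤ) : Finset ℕ :=
  open Classical in
  -- The value `n + 1` is included as the successor of the label `n`.
  (Finset.range (n + 2)).filter fun c => ∀ e, Touches e b → f e ≠ c

theorem card_missing_add_le {n : ℕ} {f : octagonalGrid.edgeSet → ℕ}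
    (hf : octagonalGrid.IsEdgeLabeling 1 2 n f) (b : ℤ × ℤ) :
    (missing f n b).card + 26 ≤ n + 2 := by
  classical
  let used := touchingOffsets.image fun x => f (edge (b + x.1) x.2)
  have hused : used.card = 26 := by
    rw [← card_touchingOffsets]
    refine Finset.card_image_of_injOn fun x hx y hy h => ?_
    have := edge_injective (a₁ := (b + x.1, x.2)) (a₂ := (b + y.1, y.2))
      (injOn_touches hf b (touches_edge_add b hx) (touches_edge_add b hy) h)
    simpa [Prod.ext_iff] using this
  have hdisj : Disjoint (missing f n b) used := by
    rw [Finset.disjoint_left]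
    intro c hc hc'
    obtain ⟨x, hx, rfl⟩ := Finset.mem_image.1 hc'
    exact (Finset.mem_filter.1 hc).2 _ (touches_edge_add b hx) rfl
  rw [← hused, ← Finset.card_union_of_disjoint hdisj]
  conv_rhs => rw [← Finset.card_range (n + 2)]
  refine Finset.card_le_card (Finset.union_subset (Finset.filter_subset _ _) fun c hc => ?_)
  obtain ⟨x, -, rfl⟩ := Finset.mem_image.1 hc
  have := hf.1 (edge (b + x.1) x.2)
  rw [Finset.mem_range]
  omega

theorem mem_box_of_touches_edge {p b : ℤ × ℤ} {d : Fin 4} (h : Touches (edge p d) b) :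
    (p.1 - 1 ≤ b.1 ∧ b.1 ≤ p.1 + 1) ∧ p.2 - 2 ≤ b.2 ∧ b.2 ≤ p.2 + 1 := by
  obtain ⟨v, hv, hvb⟩ := h
  rw [mem_block] at hvb
  simp only [edge, Sym2.mem_iff] at hv
  rcases hv with rfl | rfl
  · omega
  · fin_cases d <;> simp [direction] at hvb <;> omega

theorem twentyEight_le {n : ℕ} {f : octagonalGrid.edgeSet → ℕ}
    (hf : octagonalGrid.IsEdgeLabeling 1 2 n f) : 28 ≤ n := by
  by_contra! hn
  choose b hb hmiss using exists_touches_succ_missing hf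
  -- The window is large enough to absorb the boundary: 4 · 20² = 1600 edges against 3 · 22 · 23 =
  -- 1518 missing values.
  obtain ⟨S, hSdef⟩ : ∃ S : Finset ((ℤ × ℤ) × Fin 4),
    S = (Finset.Icc 1 20 ×ˢ Finset.Icc 1 20) ×ˢ Finset.univ := ⟨_, rfl⟩
  obtain ⟨B, hBdef⟩ : ∃ B : Finset (ℤ × ℤ), B = Finset.Icc 0 21 ×ˢ Finset.Icc (-1) 21 := ⟨_, rfl⟩
  let T : Finset (Σ _ : ℤ × ℤ, ℕ) := B.sigma (missing f n)
  have hT : T.card ≤ B.card * 3 := by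
    rw [Finset.card_sigma]
    refine Finset.sum_le_card_nsmul _ _ _ fun b _ => ?_
    have := card_missing_add_le hf b
    omega
  have hS : S.card ≤ T.card := by
    refine Finset.card_le_card_of_injOn
      (fun x => ⟨b (edge x.1 x.2), f (edge x.1 x.2) + 1⟩) (fun x hx => ?_) fun x _ y _ h => ?_
    · have hbox := mem_box_of_touches_edge (hb (edge x.1 x.2))
      have hle := hf.1 (edge x.1 x.2)
      simp only [hSdef, Finset.coe_product, Set.mem_prod, Finset.coe_Icc, Set.mem_Icc] at hx
      simp only [T, hBdef, Finset.mem_coe, Finset.mem_sigma, Finset.mem_product, Finset.mem_Icc,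
        missing, Finset.mem_filter, Finset.mem_range]
      exact ⟨by omega, by omega, hmiss _⟩
    · simp only [Sigma.mk.injEq, heq_eq_eq, add_left_inj] at h
      exact edge_injective (injOn_touches hf _ (hb _) (h.1 ▸ hb (edge y.1 y.2)) h.2)
  have hSc : S.card = 1600 := by simp [hSdef]
  have hBc : B.card = 506 := by simp [hBdef]
  omega

end octagonalGrid

theorem theorem3 :
    octagonalGrid.edgeSpan 1 2 ≠ ⊤ ∧ 28 ≤ octagonalGrid.edgeSpan 1 2 := by
  constructor
  · obtain ⟨n, hn⟩ := octagonalGrid.exists_isEdgeLabeling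
    exact ne_top_of_le_ne_top (ENat.natCast_ne_top n) (iInf₂_le n hn)
  · refine le_iInf₂ fun n hn => ?_
    obtain ⟨f, hf⟩ := hn
    exact_mod_cast octagonalGrid.twentyEight_le hf
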